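/- For a finite set $S\subset\mathbb{R}^3$ and a function $r\colon S\to(0,\infty)$, let $e_r(S)$ be the number of ordered pairs $(x,y)\in S\times S$ whose Euclidean distance is $d(x,y)=r(x)$. The pair $(S,r)$ is called a suspension with circle $\mathcal{C}$ and symmetry axis $\mathcal{L}$ if $\mathcal{C}\subset\mathbb{R}^3$ is a circle of positive radius, $\mathcal{L}$ is the line through the centre of $\mathcal{C}$ perpendicular to the plane of $\mathcal{C}$, $S\subset\mathcal{C}\cup\mathcal{L}$, and $r(x)=d(x,\mathcal{C})$ for all $x\in S\cap\mathcal{L}$. Theorem (Stability). For every $\varepsilon>0$ there exist $\delta>0$ and $n_0\in\mathbb{N}$ with the following property. If $n\ge n_0$, $S\subset\mathbb{R}^3$ is a set of $n$ points and $r\colon S\to(0,\infty)$ is a function with $e_r(S)>\left(\frac14-\delta\right)n^2$, then there are a set $T\subset S$ with $|T|<\varepsilon n$ and a circle $\mathcal{C}$ with symmetry axis $\mathcal{L}$ such that $S\setminus T$, with the restriction of $r$, is a suspension with circle $\mathcal{C}$ and symmetry axis $\mathcal{L}$, and $$\bigl||S\cap\mathcal{C}|-n/2\bigr|<\varepsilon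 n\quad\text{and}\quad \bigl||S\cap\mathcal{L}|-n/2\bigr|<\varepsilon n.$$ -/

import Mathlib

/-- Euclidean 3-space. -/
abbrev Space3 : Type := EuclideanSpace ℝ (Fin 3)

/-- A (nondegenerate) circle in Euclidean 3-space, given by its centre, its radius and a nonzero
normal vector of the plane in which it lies. -/
structure SpaceCircle where
  center : Space3
  radius : ℝ
  normal : Space3
  radius_pos : 0 < radius
  normal_ne_zero : normal ≠ 0

/-- The points of the circle. -/
def SpaceCircle.points (γ : SpaceCircle) : Set Space3 :=
  {x | dist x γ.center = γ.radius ∧ inner ℝ (x - γ.center) γ.normal = 0}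

/-- The axis of symmetry of the circle: the line through the centre, perpendicular to the plane
of the circle. -/
def SpaceCircle.axis (γ : SpaceCircle) : Set Space3 :=
  {x | ∃ t : ℝ, x = γ.center + t • γ.normal}

open Classical in
/-- The arcs of the favourite distance digraph on `S` determined by `r`. -/
noncomputable def favouriteArcs (S : Finset Space3) (r : Space3 → ℝ) : Finset (Space3 × Space3) :=
  (S ×ˢ S).filter (fun p => dist p.1 p.2 = r p.1)

/-- `e_r(S)`, the number of arcs of the favourite distance digraph. -/
noncomputable def favouriteCount (S : Finset Space3) (r : Space3 → ℝ) : ℕ :=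
  (favouriteArcs S r).card

/-- The set `S` and the function `r` (of which only the values on `S` matter) form a suspension
with circle `γ` and with the axis of symmetry of `γ`. -/
structure IsSuspension (S : Set Space3) (r : Space3 → ℝ) (γ : SpaceCircle) : Prop where
  finite : S.Finite
  pos : ∀ x ∈ S, 0 < r x
  subset : S ⊆ γ.points ∪ γ.axis
  eq_dist : ∀ x ∈ S ∩ γ.axis, r x = Metric.infDist x γ.points

/-!
The arcs leaving two points `x₁ ≠ x₂` towards common heads end on the intersection of two spheres,
that is, on a circle whose axis passes through `x₁` and `x₂`. Call a circle rich if it carries at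
least `η n` points of `S`. For a section `B = S ∩ γ` by a rich circle let `A = hub S r B` be the
set of the points of `S` that send an arc to every point of `B`; it lies on the axis of `γ`.

* The sets `A ∪ B` belonging to distinct rich circles share at most seven points
  (`card_inter_le_seven`), since two circles share at most two points, a line and a circle share at
  most two points, and two points of both hubs would determine the circle. Hence there are boundedly
  many rich circles, and `∑ (|A| + |B|) ≤ n + O(1)`.
* An arc that does not run from some `A` to its `B` is called sparse here. Two points have fewer
  than `η n` common heads along sparse arcs, so by the Cauchy–Schwarz inequality there are at most
  `√(1 / n + η) n ^ 2` of them (`card_sq_le_of_common_heads_le`).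

So `∑ |A| |B|` is almost `n ^ 2 / 4`. As `|A| |B| ≤ √(|A| |B|) (|A| + |B|) / 2`, a single rich
circle has `|A| |B|` almost `n ^ 2 / 4`, and the disjoint sets `A` and `B` then both have almost
`n / 2` elements. The exceptional set is `T = S \ (A ∪ B)`.
-/

/-! ### Circles in space -/

/-- Three distinct points of a sphere are not collinear, so the vectors orthogonal to their plane
form a line. -/
theorem exists_eq_smul_of_orthogonal {c p q s w n : Space3} {R : ℝ}
    (hp : dist p c = R) (hq : dist q c = R) (hs : dist s c = R)
    (hpq : p ≠ q) (hps : p ≠ s) (hqs : q ≠ s) (hn : n ≠ 0)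
    (hnq : inner ℝ (q - p) n = 0) (hns : inner ℝ (s - p) n = 0)
    (hwq : inner ℝ (q - p) w = 0) (hws : inner ℝ (s - p) w = 0) :
    ∃ t : ℝ, w = t • n := by
  have hco : EuclideanGeometry.Cospherical ({p, q, s} : Set Space3) :=
    ⟨c, R, by simp [hp, hq, hs]⟩
  have hai := hco.affineIndependent_of_ne hpq hps hqs
  have hli : LinearIndependent ℝ ![q - p, s - p] := by
    rw [affineIndependent_iff_linearIndependent_vsub ℝ _ (0 : Fin 3)] at hai
    have h2 := hai.comp (fun i : Fin 2 => (⟨i.succ, by simp⟩ : {x : Fin 3 // x ≠ 0}))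
      (by intro i j h; simpa using h)
    have e : ![q - p, s - p] = (fun i : {x : Fin 3 // x ≠ 0} => ![p, q, s] i -ᵥ ![p, q, s] 0) ∘
        fun i : Fin 2 => (⟨i.succ, by simp⟩ : {x : Fin 3 // x ≠ 0}) := by
      funext i
      fin_cases i <;> simp
    rw [e]
    exact h2
  set K : Submodule ℝ Space3 := Submodule.span ℝ (Set.range ![q - p, s - p]) with hK
  have hK2 : Module.finrank ℝ K = 2 := by
    rw [hK, finrank_span_eq_card hli]; simp
  have hK1 : Module.finrank ℝ Kᗮ = 1 := by
    have h := K.finrank_add_finrank_orthogonal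
    rw [hK2, finrank_euclideanSpace_fin] at h
    omega
  have hmem : ∀ v : Space3, inner ℝ (q - p) v = 0 → inner ℝ (s - p) v = 0 → v ∈ Kᗮ := by
    intro v h1 h2
    rw [Submodule.mem_orthogonal]
    intro u hu
    induction hu using Submodule.span_induction with
    | mem x hx =>
      obtain ⟨i, rfl⟩ := hx
      fin_cases i
      · simpa using h1
      · simpa using h2
    | zero => simp
    | add x y _ _ hx hy => rw [inner_add_left, hx, hy, add_zero]
    | smul a x _ hx => rw [inner_smul_left, hx, mul_zero]
  have hn0 : (⟨n, hmem n hnq hns⟩ : Kᗮ) ≠ 0 := by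
    intro h; exact hn (congrArg Subtype.val h)
  obtain ⟨t, ht⟩ := (finrank_eq_one_iff_of_nonzero' _ hn0).1 hK1 ⟨w, hmem w hwq hws⟩
  exact ⟨t, (congrArg Subtype.val ht).symm⟩

theorem inner_sub_eq_zero_of_dist_eq {x c p q : Space3}
    (hx : dist x p = dist x q) (hc : dist c p = dist c q) : inner ℝ (q - p) (x - c) = 0 := by
  have key : ∀ z : Space3, dist z p = dist z q →
      2 * inner ℝ z q - 2 * inner ℝ z p = ‖q‖ ^ 2 - ‖p‖ ^ 2 := by
    intro z hz
    have h : ‖z - p‖ ^ 2 = ‖z - q‖ ^ 2 := by rw [← dist_eq_norm, ← dist_eq_norm, hz]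
    rw [norm_sub_sq_real, norm_sub_sq_real] at h
    linarith
  have h1 := key x hx
  have h2 := key c hc
  rw [inner_sub_right, inner_sub_left, inner_sub_left, real_inner_comm x q, real_inner_comm x p,
    real_inner_comm c q, real_inner_comm c p]
  linarith

namespace SpaceCircle

theorem inner_sub_normal (γ : SpaceCircle) {p q : Space3} (hp : p ∈ γ.points)
    (hq : q ∈ γ.points) : inner ℝ (q - p) γ.normal = 0 := by
  have h : q - p = (q - γ.center) - (p - γ.center) := by abel
  rw [h, inner_sub_left, hp.2, hq.2, sub_zero]

theorem mem_axis_of_equidistant (γ : SpaceCircle) {p q s x : Space3} (hp : p ∈ γ.points)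
    (hq : q ∈ γ.points) (hs : s ∈ γ.points) (hpq : p ≠ q) (hps : p ≠ s) (hqs : q ≠ s)
    (h1 : dist x p = dist x q) (h2 : dist x p = dist x s) : x ∈ γ.axis := by
  obtain ⟨t, ht⟩ := exists_eq_smul_of_orthogonal (w := x - γ.center) hp.1 hq.1 hs.1 hpq hps hqs
    γ.normal_ne_zero (γ.inner_sub_normal hp hq) (γ.inner_sub_normal hp hs)
    (inner_sub_eq_zero_of_dist_eq h1 (by rw [dist_comm, hp.1, dist_comm, hq.1]))
    (inner_sub_eq_zero_of_dist_eq h2 (by rw [dist_comm, hp.1, dist_comm, hs.1]))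
  exact ⟨t, by rw [← ht]; abel⟩

/-- Three distinct points determine a circle. -/
theorem points_eq_of_three (γ γ' : SpaceCircle) {p q s : Space3} (hp : p ∈ γ.points)
    (hq : q ∈ γ.points) (hs : s ∈ γ.points) (hp' : p ∈ γ'.points) (hq' : q ∈ γ'.points)
    (hs' : s ∈ γ'.points) (hpq : p ≠ q) (hps : p ≠ s) (hqs : q ≠ s) :
    γ.points = γ'.points := by
  obtain ⟨t, ht⟩ := γ.mem_axis_of_equidistant (x := γ'.center) hp hq hs hpq hps hqs
    (by rw [dist_comm, hp'.1, dist_comm, hq'.1]) (by rw [dist_comm, hp'.1, dist_comm, hs'.1])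
  obtain ⟨a, ha⟩ := exists_eq_smul_of_orthogonal (w := γ'.normal) hp.1 hq.1 hs.1 hpq hps hqs
    γ.normal_ne_zero (γ.inner_sub_normal hp hq) (γ.inner_sub_normal hp hs)
    (γ'.inner_sub_normal hp' hq') (γ'.inner_sub_normal hp' hs')
  have ha0 : a ≠ 0 := by
    rintro rfl
    exact γ'.normal_ne_zero (by rw [ha, zero_smul])
  have hn0 : inner ℝ γ.normal γ.normal ≠ (0 : ℝ) := by
    simpa using γ.normal_ne_zero
  -- Both centres lie in the common plane of the circles, and on the axis of `γ`.
  have ht0 : t = 0 := by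
    have h := hp'.2
    rw [ha, ht, inner_smul_right, ← sub_sub, inner_sub_left, hp.2, inner_smul_left] at h
    simpa [ha0, γ.normal_ne_zero] using h
  have hc : γ'.center = γ.center := by rw [ht, ht0, zero_smul, add_zero]
  have hR : γ'.radius = γ.radius := by rw [← hp.1, ← hp'.1, hc]
  ext x
  simp only [points, Set.mem_ofPred_eq, hc, hR, ha, inner_smul_right, mul_eq_zero, ha0, false_or]

theorem disjoint_points_axis (γ : SpaceCircle) : Disjoint γ.points γ.axis := by
  rw [Set.disjoint_left]
  rintro x ⟨h1, h2⟩ ⟨t, rfl⟩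
  have ht : t = 0 := by simpa [inner_smul_left, γ.normal_ne_zero] using h2
  have := γ.radius_pos
  simp [ht] at h1
  linarith

/-- Three distinct points of a line do not lie on a circle. -/
theorem not_mem_axis_of_mem_points (γ γ' : SpaceCircle) {p q s : Space3} (hp : p ∈ γ.points)
    (hq : q ∈ γ.points) (hs : s ∈ γ.points) (hp' : p ∈ γ'.axis) (hq' : q ∈ γ'.axis)
    (hpq : p ≠ q) (hps : p ≠ s) (hqs : q ≠ s) : s ∉ γ'.axis := by
  intro hs'
  have hco : EuclideanGeometry.Cospherical ({p, q, s} : Set Space3) :=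
    ⟨γ.center, γ.radius, by simp [hp.1, hq.1, hs.1]⟩
  have hai := hco.affineIndependent_of_ne hpq hps hqs
  rw [affineIndependent_iff_not_collinear_set] at hai
  refine hai ((collinear_iff_exists_forall_eq_smul_vadd _).2 ⟨γ'.center, γ'.normal, ?_⟩)
  have key : ∀ x ∈ γ'.axis, ∃ t : ℝ, x = t • γ'.normal +ᵥ γ'.center := by
    rintro x ⟨t, rfl⟩
    exact ⟨t, by rw [vadd_eq_add, add_comm]⟩
  rintro x (rfl | rfl | rfl)
  exacts [key _ hp', key _ hq', key _ hs']

theorem dist_sq_of_mem_axis (γ : SpaceCircle) {t : ℝ} {y : Space3} (hy : y ∈ γ.points) :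
    dist (γ.center + t • γ.normal) y ^ 2 = γ.radius ^ 2 + t ^ 2 * ‖γ.normal‖ ^ 2 := by
  have h : y - (γ.center + t • γ.normal) = (y - γ.center) - t • γ.normal := by abel
  rw [dist_comm, dist_eq_norm, h, norm_sub_sq_real, inner_smul_right, hy.2, ← dist_eq_norm, hy.1,
    norm_smul, mul_pow, Real.norm_eq_abs, sq_abs]
  ring

theorem dist_eq_of_mem_axis (γ : SpaceCircle) {x y z : Space3} (hx : x ∈ γ.axis)
    (hy : y ∈ γ.points) (hz : z ∈ γ.points) : dist x y = dist x z := by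
  obtain ⟨t, rfl⟩ := hx
  rw [← sq_eq_sq₀ dist_nonneg dist_nonneg, γ.dist_sq_of_mem_axis hy, γ.dist_sq_of_mem_axis hz]

theorem infDist_of_mem_axis (γ : SpaceCircle) {x y : Space3} (hx : x ∈ γ.axis)
    (hy : y ∈ γ.points) : Metric.infDist x γ.points = dist x y := by
  refine le_antisymm (Metric.infDist_le_dist_of_mem hy) ?_
  refine (Metric.le_infDist ⟨y, hy⟩).2 fun z hz => ?_
  rw [γ.dist_eq_of_mem_axis hx hy hz]

/-- Two spheres with distinct centres that share more than one point meet in a circle whose axis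
passes through the centres. -/
theorem exists_of_two_spheres {x₁ x₂ y₁ y₂ : Space3} {r₁ r₂ : ℝ} (hx : x₁ ≠ x₂) (hy : y₁ ≠ y₂)
    (h11 : dist x₁ y₁ = r₁) (h12 : dist x₁ y₂ = r₁) (h21 : dist x₂ y₁ = r₂)
    (h22 : dist x₂ y₂ = r₂) :
    ∃ γ : SpaceCircle, (∀ z, dist x₁ z = r₁ → dist x₂ z = r₂ → z ∈ γ.points) ∧
      x₁ ∈ γ.axis ∧ x₂ ∈ γ.axis := by
  set n := x₂ - x₁ with hn
  have hn0 : n ≠ 0 := sub_ne_zero.2 hx.symm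
  have hnn : ‖n‖ ^ 2 ≠ 0 := pow_ne_zero 2 (norm_ne_zero_iff.2 hn0)
  -- The foot of the radical plane on the line through the centres is `x₁ + t • n`.
  set t : ℝ := (r₁ ^ 2 - r₂ ^ 2 + ‖n‖ ^ 2) / (2 * ‖n‖ ^ 2) with ht
  have htn : t * ‖n‖ ^ 2 = (r₁ ^ 2 - r₂ ^ 2 + ‖n‖ ^ 2) / 2 := by
    rw [ht]; field_simp
  set c := x₁ + t • n with hc
  have hin : ∀ z, dist x₁ z = r₁ → dist x₂ z = r₂ → inner ℝ (z - c) n = 0 := by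
    intro z h1 h2
    have e1 : ‖z - x₁‖ ^ 2 = r₁ ^ 2 := by rw [← dist_eq_norm, dist_comm, h1]
    have e2 : ‖(z - x₁) - n‖ ^ 2 = r₂ ^ 2 := by
      rw [hn, sub_sub_sub_cancel_right, ← dist_eq_norm, dist_comm, h2]
    rw [norm_sub_sq_real] at e2
    rw [hc, ← sub_sub, inner_sub_left, inner_smul_left, real_inner_self_eq_norm_sq]
    simp only [conj_trivial]
    linarith
  have hds : ∀ z, dist x₁ z = r₁ → dist x₂ z = r₂ →
      dist z c ^ 2 = r₁ ^ 2 - t ^ 2 * ‖n‖ ^ 2 := by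
    intro z h1 h2
    have e1 : ‖z - x₁‖ ^ 2 = r₁ ^ 2 := by rw [← dist_eq_norm, dist_comm, h1]
    have e3 : z - x₁ = (z - c) + t • n := by rw [hc]; abel
    rw [e3, norm_add_sq_real, inner_smul_right, hin z h1 h2, norm_smul, mul_pow,
      Real.norm_eq_abs, sq_abs] at e1
    rw [dist_eq_norm]
    linarith
  have hyc : ∃ y, dist x₁ y = r₁ ∧ dist x₂ y = r₂ ∧ y ≠ c := by
    by_cases h : y₁ = c
    · exact ⟨y₂, h12, h22, fun h' => hy (h.trans h'.symm)⟩
    · exact ⟨y₁, h11, h21, h⟩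
  obtain ⟨y, hy1, hy2, hyc⟩ := hyc
  refine ⟨⟨c, dist y c, n, dist_pos.2 hyc, hn0⟩, ?_, ⟨-t, ?_⟩, ⟨1 - t, ?_⟩⟩
  · intro z h1 h2
    refine ⟨?_, hin z h1 h2⟩
    change dist z c = dist y c
    rw [← sq_eq_sq₀ dist_nonneg dist_nonneg, hds z h1 h2, hds y hy1 hy2]
  · simp [hc]
  · simp [hc, sub_smul, hn]

end SpaceCircle

/-! ### Double counting -/

/-- Finite sets with small pairwise intersections are almost disjoint. -/
theorem sum_card_le_of_card_inter_le {ι α : Type*} [DecidableEq ι] [DecidableEq α]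
    (F : Finset ι) (X : ι → Finset α) (U : Finset α) (c : ℕ) (hU : ∀ i ∈ F, X i ⊆ U)
    (h : ∀ i ∈ F, ∀ j ∈ F, i ≠ j → (X i ∩ X j).card ≤ c) :
    ∑ i ∈ F, (X i).card ≤ U.card + c * F.card ^ 2 := by
  have key : ∑ i ∈ F, (X i).card ≤ (F.biUnion X).card + c * F.card ^ 2 := by
    clear hU
    induction F using Finset.induction_on with
    | empty => simp
    | insert a F ha ih =>
      have ih' := ih fun i hi j hj =>
        h i (Finset.mem_insert_of_mem hi) j (Finset.mem_insert_of_mem hj)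
      have h1 : (X a ∩ F.biUnion X).card ≤ F.card * c := by
        rw [Finset.inter_biUnion]
        refine Finset.card_biUnion_le_card_mul _ _ _ fun j hj => ?_
        exact h a (Finset.mem_insert_self _ _) j (Finset.mem_insert_of_mem hj)
          (by rintro rfl; exact ha hj)
      have h2 := Finset.card_union_add_card_inter (X a) (F.biUnion X)
      rw [Finset.sum_insert ha, Finset.biUnion_insert, Finset.card_insert_of_notMem ha]
      nlinarith
  refine key.trans (Nat.add_le_add_right (Finset.card_le_card ?_) _)
  exact Finset.biUnion_subset.2 hU

/-- A digraph on `S` in which distinct vertices have at most `m` common heads has few arcs: count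
the pairs of arcs with a common head. -/
theorem card_sq_le_of_common_heads_le {α : Type*} [DecidableEq α] (S : Finset α)
    (E : Finset (α × α)) (m : ℝ) (hm : 0 ≤ m) (hE : E ⊆ S ×ˢ S)
    (h : ∀ x₁ ∈ S, ∀ x₂ ∈ S, x₁ ≠ x₂ →
      ((S.filter fun y => (x₁, y) ∈ E ∧ (x₂, y) ∈ E).card : ℝ) ≤ m) :
    (E.card : ℝ) ^ 2 ≤ (1 + m) * (S.card : ℝ) ^ 3 := by
  set f : α → α → ℝ := fun x y => if (x, y) ∈ E then 1 else 0 with hf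
  have hcard : (E.card : ℝ) = ∑ y ∈ S, ∑ x ∈ S, f x y := by
    rw [Finset.sum_comm, ← Finset.sum_product', hf]
    simp only [Prod.mk.eta]
    rw [Finset.sum_boole, Finset.filter_mem_eq_inter, Finset.inter_eq_right.2 hE]
  have hpair : ∀ x₁ ∈ S, ∀ x₂ ∈ S,
      ∑ y ∈ S, f x₁ y * f x₂ y ≤ (if x₁ = x₂ then (S.card : ℝ) else 0) + m := by
    intro x₁ h1 x₂ h2
    have e : ∑ y ∈ S, f x₁ y * f x₂ y
        = ((S.filter fun y => (x₁, y) ∈ E ∧ (x₂, y) ∈ E).card : ℝ) := by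
      rw [← Finset.sum_boole]
      refine Finset.sum_congr rfl fun y _ => ?_
      by_cases a : (x₁, y) ∈ E <;> by_cases b : (x₂, y) ∈ E <;> simp [hf, a, b]
    rw [e]
    split_ifs with h12
    · have : ((S.filter fun y => (x₁, y) ∈ E ∧ (x₂, y) ∈ E).card : ℝ) ≤ S.card := by
        exact_mod_cast Finset.card_filter_le _ _
      linarith
    · simpa using h x₁ h1 x₂ h2 h12
  have hsq : ∑ y ∈ S, (∑ x ∈ S, f x y) ^ 2 ≤ (1 + m) * (S.card : ℝ) ^ 2 := by
    calc ∑ y ∈ S, (∑ x ∈ S, f x y) ^ 2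
        = ∑ x₁ ∈ S, ∑ x₂ ∈ S, ∑ y ∈ S, f x₁ y * f x₂ y := by
          simp_rw [sq, Finset.sum_mul_sum]
          rw [Finset.sum_comm]
          exact Finset.sum_congr rfl fun x₁ _ => Finset.sum_comm
      _ ≤ ∑ x₁ ∈ S, ∑ x₂ ∈ S, ((if x₁ = x₂ then (S.card : ℝ) else 0) + m) :=
          Finset.sum_le_sum fun x₁ h1 => Finset.sum_le_sum fun x₂ h2 => hpair x₁ h1 x₂ h2
      _ = (1 + m) * (S.card : ℝ) ^ 2 := by
          simp only [Finset.sum_add_distrib, Finset.sum_const, nsmul_eq_mul, Finset.sum_ite_eq]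
          rw [Finset.sum_congr rfl fun x hx => if_pos hx, Finset.sum_const, nsmul_eq_mul]
          ring
  rw [hcard]
  refine (sq_sum_le_card_mul_sum_sq (s := S)).trans ?_
  calc (S.card : ℝ) * ∑ y ∈ S, (∑ x ∈ S, f x y) ^ 2
      ≤ S.card * ((1 + m) * (S.card : ℝ) ^ 2) := by gcongr
    _ = _ := by ring

/-! ### Rich circles and their hubs -/

open Classical in
/-- The points of `S` that send an arc of the favourite distance digraph to every point of `B`. -/
noncomputable def hub (S : Finset Space3) (r : Space3 → ℝ) (B : Finset Space3) : Finset Space3 :=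
  S.filter fun x => ∀ y ∈ B, dist x y = r x

open Classical in
/-- The sections of `S` by circles that have at least `m` points. A rich circle is represented by
its section, which determines it when `m` exceeds two. -/
noncomputable def richSections (S : Finset Space3) (m : ℝ) : Finset (Finset Space3) :=
  S.powerset.filter fun B => m ≤ B.card ∧ ∃ γ : SpaceCircle, B = S.filter (· ∈ γ.points)

theorem mem_hub {S : Finset Space3} {r : Space3 → ℝ} {B : Finset Space3} {x : Space3} :
    x ∈ hub S r B ↔ x ∈ S ∧ ∀ y ∈ B, dist x y = r x := by
  simp [hub]

theorem hub_subset (S : Finset Space3) (r : Space3 → ℝ) (B : Finset Space3) : hub S r B ⊆ S :=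
  fun _ hx => (mem_hub.1 hx).1

section Rich

variable {S : Finset Space3} {r : Space3 → ℝ} {m : ℝ}

theorem exists_circle_of_mem_richSections {B : Finset Space3} (hB : B ∈ richSections S m) :
    ∃ γ : SpaceCircle, ∀ x, x ∈ B ↔ x ∈ S ∧ x ∈ γ.points := by
  classical
  obtain ⟨_, _, γ, rfl⟩ := Finset.mem_filter.1 hB
  exact ⟨γ, fun x => Finset.mem_filter⟩

theorem subset_of_mem_richSections {B : Finset Space3} (hB : B ∈ richSections S m) : B ⊆ S := by
  classical
  exact Finset.mem_powerset.1 (Finset.mem_filter.1 hB).1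

theorem le_card_of_mem_richSections {B : Finset Space3} (hB : B ∈ richSections S m) :
    m ≤ B.card := by
  classical
  exact (Finset.mem_filter.1 hB).2.1

theorem two_lt_card_of_mem_richSections (hm : 2 < m) {B : Finset Space3}
    (hB : B ∈ richSections S m) : 2 < B.card := by
  have := le_card_of_mem_richSections hB
  exact_mod_cast hm.trans_le this

theorem mem_axis_of_mem_hub {B : Finset Space3} {γ : SpaceCircle} (hγ : ∀ x ∈ B, x ∈ γ.points)
    (hB : 2 < B.card) {x : Space3} (hx : x ∈ hub S r B) : x ∈ γ.axis := by
  obtain ⟨p, q, s, hp, hq, hs, hpq, hps, hqs⟩ := Finset.two_lt_card_iff.1 hB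
  have h := (mem_hub.1 hx).2
  exact γ.mem_axis_of_equidistant (hγ p hp) (hγ q hq) (hγ s hs) hpq hps hqs
    ((h p hp).trans (h q hq).symm) ((h p hp).trans (h s hs).symm)

theorem eq_of_card_inter (B : Finset Space3) (hB : B ∈ richSections S m) (B' : Finset Space3)
    (hB' : B' ∈ richSections S m) (h : 2 < (B ∩ B').card) : B = B' := by
  obtain ⟨γ, hγ⟩ := exists_circle_of_mem_richSections hB
  obtain ⟨γ', hγ'⟩ := exists_circle_of_mem_richSections hB'
  obtain ⟨p, q, s, hp, hq, hs, hpq, hps, hqs⟩ := Finset.two_lt_card_iff.1 h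
  simp only [Finset.mem_inter, hγ, hγ'] at hp hq hs
  have e := γ.points_eq_of_three γ' hp.1.2 hq.1.2 hs.1.2 hp.2.2 hq.2.2 hs.2.2 hpq hps hqs
  ext x
  rw [hγ, hγ', e]

/-- Two points that both send arcs to all points of a rich section `B` determine `B`. -/
theorem eq_of_card_hub_inter (hm : 2 < m) (B : Finset Space3) (hB : B ∈ richSections S m)
    (B' : Finset Space3) (hB' : B' ∈ richSections S m)
    (h : 1 < (hub S r B ∩ hub S r B').card) : B = B' := by
  obtain ⟨γ, hγ⟩ := exists_circle_of_mem_richSections hB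
  obtain ⟨γ', hγ'⟩ := exists_circle_of_mem_richSections hB'
  obtain ⟨x₁, h1, x₂, h2, hx⟩ := Finset.one_lt_card.1 h
  rw [Finset.mem_inter, mem_hub, mem_hub] at h1 h2
  obtain ⟨p, q, s, hp, hq, hs, hpq, hps, hqs⟩ :=
    Finset.two_lt_card_iff.1 (two_lt_card_of_mem_richSections hm hB)
  obtain ⟨p', q', s', hp', hq', hs', hpq', hps', hqs'⟩ :=
    Finset.two_lt_card_iff.1 (two_lt_card_of_mem_richSections hm hB')
  obtain ⟨β, hβ, -, -⟩ := SpaceCircle.exists_of_two_spheres hx hpq (h1.1.2 p hp) (h1.1.2 q hq)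
    (h2.1.2 p hp) (h2.1.2 q hq)
  have k : ∀ y ∈ B, y ∈ β.points := fun y hy => hβ y (h1.1.2 y hy) (h2.1.2 y hy)
  have k' : ∀ y ∈ B', y ∈ β.points := fun y hy => hβ y (h1.2.2 y hy) (h2.2.2 y hy)
  have e := γ.points_eq_of_three β ((hγ p).1 hp).2 ((hγ q).1 hq).2 ((hγ s).1 hs).2
    (k p hp) (k q hq) (k s hs) hpq hps hqs
  have e' := γ'.points_eq_of_three β ((hγ' p').1 hp').2 ((hγ' q').1 hq').2 ((hγ' s').1 hs').2
    (k' p' hp') (k' q' hq') (k' s' hs') hpq' hps' hqs'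
  ext x
  rw [hγ, hγ', e, e']

theorem card_hub_inter_le_two (hm : 2 < m) (B : Finset Space3) (hB : B ∈ richSections S m)
    (B' : Finset Space3) (hB' : B' ∈ richSections S m) : (hub S r B ∩ B').card ≤ 2 := by
  obtain ⟨γ, hγ⟩ := exists_circle_of_mem_richSections hB
  obtain ⟨γ', hγ'⟩ := exists_circle_of_mem_richSections hB'
  by_contra! h
  obtain ⟨p, q, s, hp, hq, hs, hpq, hps, hqs⟩ := Finset.two_lt_card_iff.1 h
  rw [Finset.mem_inter, hγ'] at hp hq hs
  have k : ∀ x ∈ hub S r B, x ∈ γ.axis := fun x hx =>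
    mem_axis_of_mem_hub (fun y hy => ((hγ y).1 hy).2) (two_lt_card_of_mem_richSections hm hB) hx
  exact γ'.not_mem_axis_of_mem_points γ hp.2.2 hq.2.2 hs.2.2 (k p hp.1) (k q hq.1) hpq hps hqs
    (k s hs.1)

theorem card_inter_le_seven (hm : 2 < m) (B : Finset Space3) (hB : B ∈ richSections S m)
    (B' : Finset Space3) (hB' : B' ∈ richSections S m) (hne : B ≠ B') :
    ((hub S r B ∪ B) ∩ (hub S r B' ∪ B')).card ≤ 7 := by
  have h1 : (hub S r B ∩ hub S r B').card ≤ 1 := by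
    by_contra! h
    exact hne (eq_of_card_hub_inter hm B hB B' hB' h)
  have h2 : (B ∩ B').card ≤ 2 := by
    by_contra! h
    exact hne (eq_of_card_inter B hB B' hB' h)
  have h3 := card_hub_inter_le_two (r := r) hm B hB B' hB'
  have h4 := card_hub_inter_le_two (r := r) hm B' hB' B hB
  have e : (hub S r B ∪ B) ∩ (hub S r B' ∪ B') =
      ((hub S r B ∩ hub S r B') ∪ (hub S r B ∩ B')) ∪ ((hub S r B' ∩ B) ∪ (B ∩ B')) := by
    ext x
    simp only [Finset.mem_inter, Finset.mem_union]
    tauto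
  rw [e]
  refine (Finset.card_union_le _ _).trans ?_
  have h5 := Finset.card_union_le (hub S r B ∩ hub S r B') (hub S r B ∩ B')
  have h6 := Finset.card_union_le (hub S r B' ∩ B) (B ∩ B')
  omega

theorem disjoint_hub (hm : 2 < m) {B : Finset Space3} (hB : B ∈ richSections S m) :
    Disjoint (hub S r B) B := by
  obtain ⟨γ, hγ⟩ := exists_circle_of_mem_richSections hB
  rw [Finset.disjoint_left]
  intro x hx hxB
  exact Set.disjoint_left.1 γ.disjoint_points_axis ((hγ x).1 hxB).2
    (mem_axis_of_mem_hub (fun y hy => ((hγ y).1 hy).2) (two_lt_card_of_mem_richSections hm hB) hx)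

theorem sum_card_hub_add_card_le (hm : 2 < m) (F : Finset (Finset Space3))
    (hF : F ⊆ richSections S m) :
    ∑ B ∈ F, ((hub S r B).card + B.card) ≤ S.card + 7 * F.card ^ 2 := by
  have h := sum_card_le_of_card_inter_le F (fun B => hub S r B ∪ B) S 7
    (fun B hB => Finset.union_subset (hub_subset S r B) (subset_of_mem_richSections (hF hB)))
    (fun B hB B' hB' hne => card_inter_le_seven hm B (hF hB) B' (hF hB') hne)
  refine le_of_eq_of_le (Finset.sum_congr rfl fun B hB => ?_) h
  rw [Finset.card_union_of_disjoint (disjoint_hub hm (hF hB))]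

/-- A large set has boundedly many rich sections. -/
theorem card_richSections_lt (hm : 2 < m) (K : ℕ) (hK : 2 * (S.card : ℝ) ≤ K * m)
    (hS : 7 * K ^ 2 < S.card) : (richSections S m).card < K := by
  by_contra! h
  obtain ⟨F, hF, hFK⟩ := Finset.exists_subset_card_eq h
  have h1 := sum_card_hub_add_card_le (r := 0) hm F hF
  rw [hFK] at h1
  have h2 : (K : ℝ) * m ≤ ∑ B ∈ F, (((hub S 0 B).card : ℝ) + B.card) := by
    rw [← hFK, ← nsmul_eq_mul]
    refine Finset.card_nsmul_le_sum _ _ _ fun B hB => ?_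
    have := le_card_of_mem_richSections (hF hB)
    have : (0 : ℝ) ≤ (hub S 0 B).card := Nat.cast_nonneg _
    linarith
  have h3 : ∑ B ∈ F, (((hub S 0 B).card : ℝ) + B.card) ≤ S.card + 7 * K ^ 2 := by
    exact_mod_cast h1
  have h4 : 7 * (K : ℝ) ^ 2 < S.card := by exact_mod_cast hS
  linarith

/-- Up to sparse arcs, every arc runs from the hub of a rich section to that section. -/
theorem favouriteCount_le (hm : 2 < m) :
    (favouriteCount S r : ℝ) ≤ ∑ B ∈ richSections S m, ((hub S r B).card : ℝ) * B.card
      + √((1 + m) * (S.card : ℝ) ^ 3) := by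
  classical
  set M : Finset (Space3 × Space3) := (richSections S m).biUnion fun B => hub S r B ×ˢ B with hM
  have hMc : (M.card : ℝ) ≤ ∑ B ∈ richSections S m, ((hub S r B).card : ℝ) * B.card := by
    have : M.card ≤ ∑ B ∈ richSections S m, (hub S r B).card * B.card := by
      refine Finset.card_biUnion_le.trans (le_of_eq ?_)
      exact Finset.sum_congr rfl fun B _ => Finset.card_product _ _
    exact_mod_cast this
  have hEc : (((favouriteArcs S r) \ M).card : ℝ) ≤ √((1 + m) * (S.card : ℝ) ^ 3) := by
    refine Real.le_sqrt_of_sq_le ?_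
    refine card_sq_le_of_common_heads_le S _ m (by linarith)
      (Finset.sdiff_subset.trans (Finset.filter_subset _ _)) ?_
    intro x₁ hx1 x₂ hx2 hx
    by_contra! hlt
    set N := S.filter fun y => (x₁, y) ∈ favouriteArcs S r \ M ∧ (x₂, y) ∈ favouriteArcs S r \ M
      with hN
    have hNm : ∀ y ∈ N, y ∈ S ∧ dist x₁ y = r x₁ ∧ dist x₂ y = r x₂ ∧ (x₁, y) ∉ M := by
      intro y hy
      simp only [hN, favouriteArcs, Finset.mem_filter, Finset.mem_sdiff, Finset.mem_product] at hy
      exact ⟨hy.1, hy.2.1.1.2, hy.2.2.1.2, hy.2.1.2⟩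
    have hN2 : 2 < N.card := by exact_mod_cast hm.trans hlt
    obtain ⟨p, q, s, hp, hq, -, hpq, -, -⟩ := Finset.two_lt_card_iff.1 hN2
    obtain ⟨γ, hγ, h1, h2⟩ := SpaceCircle.exists_of_two_spheres hx hpq (hNm p hp).2.1
      (hNm q hq).2.1 (hNm p hp).2.2.1 (hNm q hq).2.2.1
    -- The common heads lie on a rich circle with `x₁` in its hub, so these arcs are not sparse.
    have hNγ : ∀ y ∈ N, y ∈ γ.points := fun y hy => hγ y (hNm y hy).2.1 (hNm y hy).2.2.1
    have hNB : N ⊆ S.filter (· ∈ γ.points) := fun y hy =>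
      Finset.mem_filter.2 ⟨(hNm y hy).1, hNγ y hy⟩
    have hB : S.filter (· ∈ γ.points) ∈ richSections S m := by
      refine Finset.mem_filter.2 ⟨Finset.mem_powerset.2 (Finset.filter_subset _ _), ?_, γ, rfl⟩
      refine hlt.le.trans ?_
      exact_mod_cast Finset.card_le_card hNB
    refine (hNm p hp).2.2.2 (Finset.mem_biUnion.2 ⟨_, hB, Finset.mem_product.2 ⟨?_, hNB hp⟩⟩)
    refine mem_hub.2 ⟨hx1, fun y hy => ?_⟩
    rw [γ.dist_eq_of_mem_axis h1 (Finset.mem_filter.1 hy).2 (hNγ p hp), (hNm p hp).2.1]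
  have hsplit : favouriteCount S r ≤ M.card + ((favouriteArcs S r) \ M).card := by
    rw [favouriteCount, add_comm]
    exact Finset.card_le_card_sdiff_add_card
  have : (favouriteCount S r : ℝ) ≤ M.card + ((favouriteArcs S r) \ M).card := by
    exact_mod_cast hsplit
  linarith

end Rich

/-! ### Stability -/

theorem sum_mul_le_of_mul_le_sq {ι : Type*} (F : Finset ι) (a b : ι → ℝ) (Q : ℝ) (hQ : 0 ≤ Q)
    (ha : ∀ i ∈ F, 0 ≤ a i) (hb : ∀ i ∈ F, 0 ≤ b i) (h : ∀ i ∈ F, a i * b i ≤ Q ^ 2) :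
    ∑ i ∈ F, a i * b i ≤ Q / 2 * ∑ i ∈ F, (a i + b i) := by
  rw [Finset.mul_sum]
  refine Finset.sum_le_sum fun i hi => ?_
  have ha' := ha i hi
  have hb' := hb i hi
  have hab : 0 ≤ a i * b i := mul_nonneg ha' hb'
  refine abs_le_of_sq_le_sq' ?_ (by positivity) |>.2
  calc (a i * b i) ^ 2 = (a i * b i) * (a i * b i) := sq _
    _ ≤ Q ^ 2 * ((a i + b i) / 2) ^ 2 :=
        mul_le_mul (h i hi) (by nlinarith [sq_nonneg (a i - b i)]) hab (by positivity)
    _ = (Q / 2 * (a i + b i)) ^ 2 := by ring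

theorem abs_sub_half_lt {a b n κ ε : ℝ} (hε : 0 < ε) (hn : 0 < n) (hκε : κ ≤ ε ^ 2)
    (hb : 0 ≤ b) (hab : a + b ≤ n) (h : ((1 / 2 - κ) * n) ^ 2 < a * b) :
    |b - n / 2| < ε * n := by
  refine abs_lt_of_sq_lt_sq ?_ (by positivity)
  have h1 : a * b ≤ (n - b) * b := mul_le_mul_of_nonneg_right (by linarith) hb
  have h2 : (b - n / 2) ^ 2 < κ * n ^ 2 := by nlinarith [sq_nonneg (κ * n)]
  have h3 : κ * n ^ 2 ≤ ε ^ 2 * n ^ 2 := by gcongr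
  rw [mul_pow]
  linarith

/-- Some rich circle and its hub account for almost all arcs. -/
theorem exists_large_hub (κ : ℝ) (hκ : 0 < κ) (hκ2 : κ ≤ 1 / 2) :
    ∃ n₀ : ℕ, ∀ (S : Finset Space3) (r : Space3 → ℝ), n₀ ≤ S.card →
      (1 / 4 - κ / 4) * (S.card : ℝ) ^ 2 < (favouriteCount S r : ℝ) →
      0 < S.card ∧ ∃ m : ℝ, 2 < m ∧ ∃ B ∈ richSections S m,
        ((1 / 2 - κ) * (S.card : ℝ)) ^ 2 < ((hub S r B).card : ℝ) * B.card := by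
  -- `η` and `n₀` are such that there are at most `(κ / 8) n ^ 2` sparse arcs.
  set η : ℝ := κ ^ 2 / 128 with hη
  have hη0 : 0 < η := by positivity
  set K : ℕ := ⌈2 / η⌉₊ with hK
  have hKη : 2 ≤ K * η := (div_le_iff₀ hη0).1 (Nat.le_ceil _)
  refine ⟨max (max (7 * K ^ 2 + 1) ⌈3 / η⌉₊) ⌈14 * (K : ℝ) ^ 2 / κ⌉₊, ?_⟩
  intro S r hS he
  simp only [max_le_iff] at hS
  obtain ⟨⟨hS1, hS2⟩, hS3⟩ := hS
  have hn : 0 < S.card := by omega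
  set n : ℝ := (S.card : ℝ) with hndef
  have hn0 : 0 < n := Nat.cast_pos.2 hn
  have hn2 : 3 ≤ n * η := (div_le_iff₀ hη0).1 (Nat.ceil_le.1 hS2)
  have hn3 : 14 * (K : ℝ) ^ 2 ≤ n * κ := (div_le_iff₀ hκ).1 (Nat.ceil_le.1 hS3)
  have hm : 2 < η * n := by linarith
  refine ⟨hn, η * n, hm, ?_⟩
  by_contra! hcon
  have hQ : 0 ≤ (1 / 2 - κ) * n := mul_nonneg (by linarith) hn0.le
  have h1 := sum_mul_le_of_mul_le_sq (richSections S (η * n)) (fun B => ((hub S r B).card : ℝ))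
    (fun B => (B.card : ℝ)) _ hQ (fun _ _ => Nat.cast_nonneg _) (fun _ _ => Nat.cast_nonneg _) hcon
  have hk : (richSections S (η * n)).card < K := by
    refine card_richSections_lt hm K ?_ (by omega)
    nlinarith
  have h2 : ∑ B ∈ richSections S (η * n), (((hub S r B).card : ℝ) + B.card)
      ≤ n + 7 * (K : ℝ) ^ 2 := by
    have h := sum_card_hub_add_card_le (r := r) hm _ (Finset.Subset.refl (richSections S (η * n)))
    have h' : ∑ B ∈ richSections S (η * n), ((hub S r B).card + B.card)
        ≤ S.card + 7 * K ^ 2 := by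
      refine h.trans ?_
      gcongr
    rw [hndef]
    exact_mod_cast h'
  have h3 : √((1 + η * n) * n ^ 3) ≤ κ / 8 * n ^ 2 := by
    refine Real.sqrt_le_iff.2 ⟨by positivity, ?_⟩
    have : (1 + η * n) ≤ 2 * η * n := by linarith
    calc (1 + η * n) * n ^ 3 ≤ (2 * η * n) * n ^ 3 := by gcongr
      _ = (κ / 8 * n ^ 2) ^ 2 := by rw [hη]; ring
  have h4 := favouriteCount_le (S := S) (r := r) hm
  have h5 : (1 / 2 - κ) * n / 2 * ∑ B ∈ richSections S (η * n), (((hub S r B).card : ℝ) + B.card)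
      ≤ (1 / 2 - κ) * n / 2 * (n + 7 * (K : ℝ) ^ 2) := by gcongr
  have h6 : (1 / 2 - κ) * n / 2 * (n + 7 * (K : ℝ) ^ 2) ≤ (1 / 4 - 3 * κ / 8) * n ^ 2 := by
    have a1 : (1 / 2 - κ) * n / 2 * (7 * (K : ℝ) ^ 2) ≤ n / 4 * (n * κ / 2) := by
      refine mul_le_mul ?_ (by linarith) (by positivity) (by positivity)
      nlinarith
    nlinarith
  linarith

theorem mainTheorem3 (ε : ℝ) (hε : 0 < ε) :
    ∃ δ : ℝ, 0 < δ ∧ ∃ n₀ : ℕ, ∀ n : ℕ, n₀ ≤ n →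
      ∀ (S : Finset Space3) (r : Space3 → ℝ), S.card = n → (∀ x ∈ S, 0 < r x) →
        (1 / 4 - δ) * (n : ℝ) ^ 2 < (favouriteCount S r : ℝ) →
        ∃ (T : Finset Space3) (γ : SpaceCircle),
          T ⊆ S ∧ (T.card : ℝ) < ε * n ∧
          IsSuspension ((S : Set Space3) \ (T : Set Space3)) r γ ∧
          |(((S : Set Space3) ∩ γ.points).ncard : ℝ) - (n : ℝ) / 2| < ε * n ∧
          |(((S : Set Space3) ∩ γ.axis).ncard : ℝ) - (n : ℝ) / 2| < ε * n := by
  classical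
  set κ : ℝ := min (min (ε ^ 2) (ε / 2)) (1 / 2)
  have hκ0 : 0 < κ := by positivity
  have hκ1 : κ ≤ ε ^ 2 := (min_le_left _ _).trans (min_le_left _ _)
  have hκ2 : κ ≤ ε / 2 := (min_le_left _ _).trans (min_le_right _ _)
  have hκ3 : κ ≤ 1 / 2 := min_le_right _ _
  obtain ⟨n₀, hn₀⟩ := exists_large_hub κ hκ0 hκ3
  refine ⟨κ / 4, by positivity, n₀, ?_⟩
  rintro n hn S r rfl hr he
  obtain ⟨hS, m, hm, B, hB, hbig⟩ := hn₀ S r hn he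
  have hn0 : (0 : ℝ) < S.card := by exact_mod_cast hS
  obtain ⟨γ, hγ⟩ := exists_circle_of_mem_richSections hB
  have hB2 := two_lt_card_of_mem_richSections hm hB
  have hBS := subset_of_mem_richSections hB
  have haxis : ∀ x ∈ hub S r B, x ∈ γ.axis := fun x hx =>
    mem_axis_of_mem_hub (fun y hy => ((hγ y).1 hy).2) hB2 hx
  have hdisj := disjoint_hub (r := r) hm hB
  have hXS : hub S r B ∪ B ⊆ S := Finset.union_subset (hub_subset S r B) hBS
  have hpts : (S : Set Space3) ∩ γ.points = B := by
    ext x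
    simp [hγ]
  have hax : (S : Set Space3) ∩ γ.axis = (S.filter (· ∈ γ.axis) : Finset Space3) := by
    ext x
    simp
  have hsub : hub S r B ⊆ S.filter (· ∈ γ.axis) := fun x hx =>
    Finset.mem_filter.2 ⟨hub_subset S r B hx, haxis x hx⟩
  have hcardX : ((hub S r B ∪ B).card : ℝ) = (hub S r B).card + B.card := by
    rw [Finset.card_union_of_disjoint hdisj]
    push_cast
    rfl
  have hle : ((S.filter (· ∈ γ.axis)).card : ℝ) + B.card ≤ S.card := by
    have hd : Disjoint (S.filter (· ∈ γ.axis)) B := by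
      rw [Finset.disjoint_left]
      intro x hx hxB
      exact Set.disjoint_left.1 γ.disjoint_points_axis ((hγ x).1 hxB).2 (Finset.mem_filter.1 hx).2
    have := Finset.card_le_card (Finset.union_subset (Finset.filter_subset (· ∈ γ.axis) S) hBS)
    rw [Finset.card_union_of_disjoint hd] at this
    exact_mod_cast this
  have hcardA : ((hub S r B).card : ℝ) ≤ (S.filter (· ∈ γ.axis)).card := by
    exact_mod_cast Finset.card_le_card hsub
  have hbig' : ((1 / 2 - κ) * (S.card : ℝ)) ^ 2
      < ((S.filter (· ∈ γ.axis)).card : ℝ) * B.card :=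
    hbig.trans_le (by gcongr)
  refine ⟨S \ (hub S r B ∪ B), γ, Finset.sdiff_subset, ?_, ?_, ?_, ?_⟩
  · have hc : ((S \ (hub S r B ∪ B)).card : ℝ) + (hub S r B ∪ B).card = S.card := by
      exact_mod_cast Finset.card_sdiff_add_card_eq_card hXS
    -- The inequality of the arithmetic and geometric means.
    have hsum : 2 * ((1 / 2 - κ) * (S.card : ℝ)) < (hub S r B).card + B.card := by
      refine abs_lt_of_sq_lt_sq' ?_ (by positivity) |>.2
      nlinarith [sq_nonneg (((hub S r B).card : ℝ) - B.card)]
    nlinarith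
  · have hST : (S : Set Space3) \ ((S \ (hub S r B ∪ B) : Finset Space3) : Set Space3)
        = (hub S r B : Set Space3) ∪ B := by
      rw [← Finset.coe_sdiff, Finset.sdiff_sdiff_eq_self hXS, Finset.coe_union]
    rw [hST]
    refine ⟨(Finset.finite_toSet _).union (Finset.finite_toSet _), ?_, ?_, ?_⟩
    · rintro x (hx | hx)
      exacts [hr x (hub_subset S r B hx), hr x (hBS hx)]
    · rintro x (hx | hx)
      exacts [Or.inr (haxis x hx), Or.inl ((hγ x).1 hx).2]
    · rintro x ⟨hx | hx, hxa⟩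
      · obtain ⟨p, hp⟩ : B.Nonempty := Finset.card_pos.1 (by omega)
        rw [γ.infDist_of_mem_axis hxa ((hγ p).1 hp).2, (mem_hub.1 hx).2 p hp]
      · exact absurd hxa (Set.disjoint_left.1 γ.disjoint_points_axis ((hγ x).1 hx).2)
  · rw [hpts, Set.ncard_coe_finset]
    exact abs_sub_half_lt hε hn0 hκ1 (Nat.cast_nonneg _) hle hbig'
  · rw [hax, Set.ncard_coe_finset]
    refine abs_sub_half_lt hε hn0 hκ1 (Nat.cast_nonneg _) (by rw [add_comm]; exact hle)
      (by rw [mul_comm (B.card : ℝ)]; exact hbig')
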